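/- **Theorem.** All graphs are finite and simple. A graph is hamiltonian (traceable) if it contains a spanning cycle (spanning path). A *platypus* is a non-hamiltonian graph $G$ with at least three vertices such that for every vertex $v$ the vertex-deleted subgraph $G-v$ is traceable. The girth of a graph is the length of a shortest cycle in it. Then every planar platypus has girth at most $9$; that is, every planar platypus contains a cycle of length at most $9$. -/

import Mathlib

namespace SimpleGraph

/-- `G` is traceable: it contains a Hamiltonian path. -/
def IsTraceable {V : Type*} [DecidableEq V] (G : SimpleGraph V) : Prop :=
  ∃ (a b : V) (p : G.Walk a b), p.IsHamiltonian

/-- A platypus: a non-Hamiltonian finite graph on at least three vertices all of whose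
vertex-deleted subgraphs `G - v` are traceable. -/
structure IsPlatypus {V : Type*} [Fintype V] [DecidableEq V] (G : SimpleGraph V) : Prop where
  three_le_card : 3 ≤ Fintype.card V
  not_isHamiltonian : ¬ G.IsHamiltonian
  traceable_delete : ∀ v : V, (G.induce {w : V | w ≠ v}).IsTraceable

/-- `S` is a simple arc in the Euclidean plane with end points `a` and `b`. -/
def IsPlaneArc (a b : EuclideanSpace ℝ (Fin 2)) (S : Set (EuclideanSpace ℝ (Fin 2))) : Prop :=
  ∃ γ : _root_.Path a b, Function.Injective γ ∧ Set.range γ = S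

/-- `G` is planar: it can be drawn in the Euclidean plane, with distinct points for the vertices
and, for each edge, a simple arc between the points of its two ends, such that an arc passes
through no vertex other than its ends and two different arcs meet only in common ends. -/
def IsPlanar {V : Type*} (G : SimpleGraph V) : Prop :=
  ∃ (pos : V → EuclideanSpace ℝ (Fin 2)) (arc : Sym2 V → Set (EuclideanSpace ℝ (Fin 2))),
    Function.Injective pos ∧
    (∀ u v : V, G.Adj u v → IsPlaneArc (pos u) (pos v) (arc s(u, v))) ∧
    (∀ e ∈ G.edgeSet, ∀ w : V, pos w ∈ arc e → w ∈ e) ∧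
    (∀ e ∈ G.edgeSet, ∀ f ∈ G.edgeSet, e ≠ f →
      arc e ∩ arc f ⊆ pos '' {w : V | w ∈ e ∧ w ∈ f})

end SimpleGraph

/-! Two bounds on the number m of edges against the number n of vertices contradict each other if a
planar platypus has girth at least 10.

Lower bound, 5n ≤ 4m (`IsPlatypus.five_mul_card_le`): all degrees are at least 2. A degree-2
neighbour of v keeps only one neighbour in G - v, so it is an end of every hamiltonian path of G -
v. Two such neighbours would be its two ends, and v would close the path to a hamiltonian cycle. So
each vertex has at most one neighbour of degree 2, at most n/2 vertices have degree 2, and the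
degree sum is at least 3n - n/2.

Upper bound, 4m < 5n (`GridMinorModel.card_edgeFinset_lt`): this is Euler's formula in MacLane's
algebraic form. Over the field with two elements, the cycle space has dimension at least m - n + 1.
Face boundaries span it, sum to zero and use each edge at most twice. Each nonzero boundary has at
least 10 edges.

The Jordan curve theorem is avoided: a drawing is discretized to a minor model in the square grid,
where faces are classes of unit squares. There, spanning amounts to the vanishing of the mod 2
cohomology of the plane, proved by explicit summation in `exists_face_potential`. -/

namespace SimpleGraph

/-! ### Degrees in a platypus -/

section Platypus

variable {V : Type*} {G : SimpleGraph V}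

theorem Walk.IsPath.exists_two_adj {a b x : V} {p : G.Walk a b} (hp : p.IsPath)
    (hx : x ∈ p.support) (hxa : x ≠ a) (hxb : x ≠ b) :
    ∃ y z, y ≠ z ∧ G.Adj x y ∧ G.Adj x z := by
  obtain ⟨n, rfl, hn⟩ := Walk.mem_support_iff_exists_getVert.mp hx
  have hn0 : n ≠ 0 := by rintro rfl; simp at hxa
  have hnl : n ≠ p.length := by rintro rfl; simp at hxb
  refine ⟨p.getVert (n - 1), p.getVert (n + 1), fun h => ?_, ?_, p.adj_getVert_succ (by omega)⟩
  · have := hp.getVert_injOn (by simp; omega) (by simp; omega) h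
    omega
  · have := p.adj_getVert_succ (i := n - 1) (by omega)
    rw [Nat.sub_add_cancel (by omega)] at this
    exact this.symm

theorem Walk.IsHamiltonian.connected [DecidableEq V] {a b : V} {p : G.Walk a b}
    (hp : p.IsHamiltonian) : G.Connected :=
  have : Nonempty V := ⟨a⟩
  ⟨fun u v => ((p.takeUntil u (hp.mem_support u)).reachable.symm.trans
    (p.takeUntil v (hp.mem_support v)).reachable)⟩

variable [Fintype V] [DecidableEq V]

theorem IsPlatypus.exists_adj_ne (hG : G.IsPlatypus) {x v : V} (hxv : x ≠ v) :
    ∃ y, y ≠ v ∧ G.Adj x y := by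
  obtain ⟨a, b, p, hp⟩ := hG.traceable_delete v
  have hc : 2 < Fintype.card V := hG.three_le_card
  obtain ⟨u, hu⟩ : ∃ u, u ∉ ({x, v} : Finset V) := by
    by_contra! h
    have := Finset.card_le_card (fun u _ => h u : (Finset.univ : Finset V) ⊆ {x, v})
    have := Finset.card_le_two (a := x) (b := v)
    rw [Finset.card_univ] at *
    omega
  simp only [Finset.mem_insert, Finset.mem_singleton, not_or] at hu
  have : Nontrivial {w : V | w ≠ v} :=
    ⟨⟨x, hxv⟩, ⟨u, hu.2⟩, fun h => hu.1 (congrArg Subtype.val h).symm⟩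
  obtain ⟨y, hy⟩ := hp.connected.preconnected.exists_adj_of_nontrivial ⟨x, hxv⟩
  exact ⟨y, y.2, by simpa using hy⟩

theorem IsPlatypus.two_le_degree [DecidableRel G.Adj] (hG : G.IsPlatypus) (x : V) :
    2 ≤ G.degree x := by
  have : Nontrivial V := Fintype.one_lt_card_iff_nontrivial.mp
    (lt_of_lt_of_le (by norm_num) hG.three_le_card)
  obtain ⟨v, hv⟩ := exists_ne x
  obtain ⟨w, -, hw⟩ := hG.exists_adj_ne hv.symm
  obtain ⟨y, hyw, hy⟩ := hG.exists_adj_ne hw.ne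
  rw [← card_neighborFinset_eq_degree]
  exact Finset.one_lt_card.mpr ⟨w, by simpa using hw, y, by simpa using hy, hyw.symm⟩

theorem isHamiltonian_of_path_delete {v : V} (hc : 3 ≤ Fintype.card V)
    {a b : {w : V | w ≠ v}} {p : (G.induce {w : V | w ≠ v}).Walk a b} (hp : p.IsHamiltonian)
    (ha : G.Adj v a) (hb : G.Adj v b) : G.IsHamiltonian := by
  intro _
  let f := Embedding.induce (G := G) {w : V | w ≠ v}
  obtain ⟨q, hqp, hqs, hql⟩ : ∃ q : G.Walk (a : V) (b : V), q.IsPath ∧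
      q.support = p.support.map f.toHom ∧ q.length = p.length :=
    ⟨p.map f.toHom, hp.isPath.map f.injective, p.support_map _, p.length_map _⟩
  have hv : v ∉ q.support := by
    intro h
    rw [hqs, List.mem_map] at h
    obtain ⟨w, -, hw⟩ := h
    exact w.2 hw
  have hlen : q.length = Fintype.card V - 2 := by
    have : Fintype.card {w : V | w ≠ v} = Fintype.card V - 1 := by
      simp [Finset.filter_ne', Finset.card_erase_of_mem]
    rw [hql, hp.length_eq, this]
    omega
  -- With equal ends the closing walk would use one edge twice; three vertices make the path
  -- nontrivial.
  have hab : (a : V) ≠ b := by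
    intro h
    have h' := (Subtype.ext h : a = b)
    subst h'
    have : q = Walk.nil := by simpa using hqp
    rw [this] at hlen
    simp at hlen
    omega
  refine ⟨b, Walk.cons hb.symm (Walk.cons ha q), ?_⟩
  rw [Walk.isHamiltonianCycle_iff_isCycle_and_length_eq]
  refine ⟨?_, by simp [hlen]; omega⟩
  rw [Walk.cons_isCycle_iff]
  refine ⟨hqp.cons hv, ?_⟩
  rw [Walk.edges_cons, List.mem_cons, not_or]
  refine ⟨fun h => ?_, fun h => hv (Walk.snd_mem_support_of_mem_edges q h)⟩
  rw [Sym2.eq_swap, Sym2.congr_right] at h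
  exact hab h.symm

/-- An inner vertex of a hamiltonian path of G - v that is adjacent to v has degree at least 3. So
`x` and `y` are ends of the path, and distinct ones would give a hamiltonian cycle through v. -/
theorem IsPlatypus.eq_of_adj_of_degree_le_two [DecidableRel G.Adj] (hG : G.IsPlatypus)
    {v x y : V} (hx : G.Adj v x) (hy : G.Adj v y) (hdx : G.degree x ≤ 2)
    (hdy : G.degree y ≤ 2) : x = y := by
  obtain ⟨a, b, p, hp⟩ := hG.traceable_delete v
  have key : ∀ x, G.Adj v x → G.degree x ≤ 2 → x = a ∨ x = b := by
    intro x hx hd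
    by_contra! h
    obtain ⟨s, t, hst, hs, ht⟩ := hp.isPath.exists_two_adj (x := ⟨x, hx.ne'⟩) (hp.mem_support _)
      (fun h' => h.1 (congrArg Subtype.val h')) (fun h' => h.2 (congrArg Subtype.val h'))
    have hst' : (s : V) ≠ t := fun h => hst (Subtype.ext h)
    rw [← card_neighborFinset_eq_degree] at hd
    refine absurd hd (not_le.mpr (Finset.two_lt_card.mpr
      ⟨v, by simpa using hx.symm, s, by simpa using hs, t, by simpa using ht,
        fun h => s.2 h.symm, fun h => t.2 h.symm, hst'⟩))
  have hnot : ¬ (G.Adj v a ∧ G.Adj v b) := fun h =>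
    hG.not_isHamiltonian (isHamiltonian_of_path_delete hG.three_le_card hp h.1 h.2)
  rcases key x hx hdx with rfl | rfl <;> rcases key y hy hdy with rfl | rfl
  · rfl
  · exact absurd ⟨hx, hy⟩ hnot
  · exact absurd ⟨hy, hx⟩ hnot
  · rfl

theorem IsPlatypus.five_mul_card_le [DecidableRel G.Adj] (hG : G.IsPlatypus) :
    5 * Fintype.card V ≤ 4 * G.edgeFinset.card := by
  set T : Finset V := Finset.univ.filter fun x => G.degree x ≤ 2 with hT
  have hdeg : ∀ x, 3 ≤ G.degree x + if x ∈ T then 1 else 0 := by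
    intro x
    have := hG.two_le_degree x
    split_ifs with h
    · omega
    · simp [hT] at h
      omega
  have h1 : 3 * Fintype.card V ≤ 2 * G.edgeFinset.card + T.card := by
    have := Finset.sum_le_sum fun x (_ : x ∈ Finset.univ) => hdeg x
    rw [Finset.sum_add_distrib, G.sum_degrees_eq_twice_card_edges] at this
    simpa [mul_comm] using this
  -- Double count of adjacent pairs (x, v) with x in `T`: at least two for each x, at most one for
  -- each v.
  have h2 : T.card * 2 ≤ (Finset.univ : Finset V).card * 1 := by
    refine Finset.card_mul_le_card_mul G.Adj (fun x _ => ?_) (fun v _ => ?_)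
    · have := hG.two_le_degree x
      rw [← card_neighborFinset_eq_degree] at this
      refine this.trans (le_of_eq (congrArg _ ?_))
      ext; simp [Finset.bipartiteAbove]
    · refine Finset.card_le_one.mpr fun x hx y hy => ?_
      simp only [Finset.bipartiteBelow, Finset.mem_filter, hT, Finset.mem_univ, true_and] at hx hy
      exact hG.eq_of_adj_of_degree_le_two hx.2.symm hy.2.symm hx.1 hy.1
  rw [Finset.card_univ] at h2
  omega

end Platypus
end SimpleGraph

/-! ### The cycle space over the field with two elements -/

namespace SimpleGraph

section CycleSpace

theorem sum_sum_eq_zero_of_symm {α : Type*} [DecidableEq α] (S : Finset α) (c : α → α → ZMod 2)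
    (hs : ∀ x y, c x y = c y x) (h0 : ∀ x, c x x = 0) : ∑ x ∈ S, ∑ y ∈ S, c x y = 0 := by
  induction S using Finset.induction_on with
  | empty => simp
  | insert a S ha ih =>
    simp only [Finset.sum_insert ha, Finset.sum_add_distrib, ih, h0, zero_add, add_zero]
    rw [Finset.sum_congr rfl fun x _ => hs x a, CharTwo.add_self_eq_zero]

variable {V : Type*} [Fintype V]

/-- The cycle space of `G` over the field with two elements: the functions on the edges of `G`
whose sum around each vertex vanishes. -/
def cycleSpace (G : SimpleGraph V) : Submodule (ZMod 2) (Sym2 V → ZMod 2) where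
  carrier := {z | (∀ e ∉ G.edgeSet, z e = 0) ∧ ∀ v, ∑ w, z s(v, w) = 0}
  zero_mem' := by simp
  add_mem' := by
    rintro a b ⟨ha, ha'⟩ ⟨hb, hb'⟩
    refine ⟨fun e he => by simp [ha e he, hb e he], fun v => ?_⟩
    simp [Finset.sum_add_distrib, ha', hb']
  smul_mem' := by
    rintro c a ⟨ha, ha'⟩
    refine ⟨fun e he => by simp [ha e he], fun v => ?_⟩
    simp [← Finset.mul_sum, ha']

variable {G : SimpleGraph V}

theorem mem_cycleSpace {z : Sym2 V → ZMod 2} :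
    z ∈ G.cycleSpace ↔ (∀ e ∉ G.edgeSet, z e = 0) ∧ ∀ v, ∑ w, z s(v, w) = 0 := Iff.rfl

variable [DecidableEq V]

/-- The support contains a cycle. Otherwise a support edge is a bridge of the support; adding the
vertex conditions on one side of it cancels the inner edges and leaves only the bridge, whose value
would be 0. -/
theorem egirth_le_card_support {z : Sym2 V → ZMod 2} (hz : z ∈ G.cycleSpace) (hz0 : z ≠ 0) :
    G.egirth ≤ (Finset.univ.filter fun e => z e ≠ 0).card := by
  classical
  rw [mem_cycleSpace] at hz
  obtain ⟨hzE, hzV⟩ := hz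
  have hE : ∀ e, z e ≠ 0 → e ∈ G.edgeSet := fun e he => by_contra fun h => he (hzE e h)
  let G' : SimpleGraph V := fromEdgeSet {e | z e ≠ 0}
  have hadj : ∀ x y, G'.Adj x y ↔ z s(x, y) ≠ 0 := by
    intro x y
    simp only [G', fromEdgeSet_adj, Set.mem_ofPred_eq, and_iff_left_iff_imp]
    exact fun h => G.ne_of_adj (hE _ h)
  have hle : G' ≤ G := fun x y h => hE _ ((hadj x y).mp h)
  have hcyc : ¬ G'.IsAcyclic := by
    intro hac
    obtain ⟨e, he⟩ := Function.ne_iff.mp hz0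
    induction e with | h u v =>
    have hbr := (isAcyclic_iff_forall_isBridge.mp hac) (e := s(u, v)) ((hadj u v).mpr he)
    rw [isBridge_iff] at hbr
    set D := G'.deleteEdges {s(u, v)} with hD
    let S : Finset V := Finset.univ.filter fun x => D.Reachable u x
    have hu : u ∈ S := by simp [S]
    have hv : v ∉ S := by simpa [S] using hbr
    have hcut : ∀ x ∈ S, ∀ y ∈ Sᶜ, z s(x, y) ≠ 0 → x = u ∧ y = v := by
      intro x hx y hy hxy
      have hxe : s(x, y) = s(u, v) := by
        by_contra hne
        refine (Finset.mem_compl.mp hy) ?_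
        simp only [S, Finset.mem_filter, Finset.mem_univ, true_and] at hx ⊢
        refine hx.trans (Adj.reachable ?_)
        rw [hD, deleteEdges_adj]
        exact ⟨(hadj x y).mpr hxy, hne⟩
      rcases Sym2.eq_iff.mp hxe with h | h
      · exact h
      · exact absurd (h.1 ▸ hx) hv
    have h1 : ∑ x ∈ S, ∑ y, z s(x, y) = 0 := Finset.sum_eq_zero fun x _ => hzV x
    have h2 : ∑ x ∈ S, ∑ y ∈ S, z s(x, y) = 0 :=
      sum_sum_eq_zero_of_symm S (fun x y => z s(x, y)) (fun x y => by rw [Sym2.eq_swap])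
        fun x => hzE _ (by simp)
    have h3 : ∑ x ∈ S, ∑ y ∈ Sᶜ, z s(x, y) = z s(u, v) := by
      rw [Finset.sum_eq_single_of_mem u hu, Finset.sum_eq_single_of_mem v (by simpa using hv)]
      · exact fun y hy hne => by_contra fun h => hne (hcut u hu y hy h).2
      · exact fun x hx hne => Finset.sum_eq_zero fun y hy =>
          by_contra fun h => hne (hcut x hx y hy h).1
    refine he ?_
    simp only [← Finset.sum_add_sum_compl S, Finset.sum_add_distrib, h2, h3, zero_add] at h1
    exact h1
  simp only [IsAcyclic, not_forall, not_not] at hcyc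
  obtain ⟨v, c, hc⟩ := hcyc
  have h1 := egirth_le_length (hc.mapLe hle)
  refine h1.trans ?_
  rw [Walk.length_mapLe]
  refine Nat.cast_le.mpr (hc.isTrail.length_le_card_edgeFinset.trans (Finset.card_le_card ?_))
  intro e he
  induction e with | h x y =>
  simpa [hadj] using he

/-- Rank-nullity for the boundary map from edges to vertices: its image lies in the functions of
total sum zero, a space of dimension n - 1. -/
theorem card_edgeFinset_lt_finrank_cycleSpace_add [Nonempty V] [DecidableRel G.Adj] :
    G.edgeFinset.card + 1 ≤ Module.finrank (ZMod 2) G.cycleSpace + Fintype.card V := by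
  let ext : (G.edgeFinset → ZMod 2) →ₗ[ZMod 2] (Sym2 V → ZMod 2) :=
    { toFun := fun z e => if h : e ∈ G.edgeFinset then z ⟨e, h⟩ else 0
      map_add' := fun a b => by ext e; by_cases h : e ∈ G.edgeSet <;> simp [h]
      map_smul' := fun c a => by ext e; by_cases h : e ∈ G.edgeSet <;> simp [h] }
  have hext : ∀ z (e : Sym2 V), e ∉ G.edgeFinset → ext z e = 0 := fun z e h => dif_neg h
  have hinj : Function.Injective ext := by
    intro a b hab
    funext e
    have : ext a e = ext b e := by rw [hab]
    simpa [ext, mem_edgeFinset.mp e.2] using this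
  let bd : (Sym2 V → ZMod 2) →ₗ[ZMod 2] (V → ZMod 2) :=
    { toFun := fun z v => ∑ w, z s(v, w)
      map_add' := fun a b => by ext v; simp [Finset.sum_add_distrib]
      map_smul' := fun c a => by ext v; simp [Finset.mul_sum] }
  let tot : (V → ZMod 2) →ₗ[ZMod 2] ZMod 2 :=
    { toFun := fun z => ∑ v, z v
      map_add' := fun a b => by simp [Finset.sum_add_distrib]
      map_smul' := fun c a => by simp [Finset.mul_sum] }
  have htot : tot.range = ⊤ := by
    rw [LinearMap.range_eq_top]
    intro c
    obtain ⟨v⟩ := ‹Nonempty V›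
    exact ⟨Pi.single v c, by simp [tot]⟩
  have hr : (bd ∘ₗ ext).range ≤ tot.ker := by
    rintro _ ⟨z, rfl⟩
    rw [LinearMap.mem_ker]
    exact sum_sum_eq_zero_of_symm Finset.univ (fun x y => ext z s(x, y))
      (fun x y => by rw [Sym2.eq_swap]) fun x => hext z _ (by simp)
  have h1 := LinearMap.finrank_range_add_finrank_ker tot
  rw [htot, finrank_top, Module.finrank_self, Module.finrank_fintype_fun_eq_card] at h1
  have h2 := LinearMap.finrank_range_add_finrank_ker (bd ∘ₗ ext)
  rw [Module.finrank_fintype_fun_eq_card, Fintype.card_coe] at h2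
  have h3 := Submodule.finrank_mono hr
  have h4 : Module.finrank (ZMod 2) (bd ∘ₗ ext).ker ≤ Module.finrank (ZMod 2) G.cycleSpace := by
    have hmem : ∀ z : (bd ∘ₗ ext).ker, ext z ∈ G.cycleSpace := fun z =>
      mem_cycleSpace.mpr ⟨fun e he => hext z e (by simpa using he),
        fun v => congrFun (LinearMap.mem_ker.mp z.2) v⟩
    refine LinearMap.finrank_le_finrank_of_injective
      (f := (ext ∘ₗ (bd ∘ₗ ext).ker.subtype).codRestrict G.cycleSpace hmem) ?_
    intro a b hab
    exact Subtype.ext (hinj (congrArg Subtype.val hab))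
  omega

/-- If the cycle space has a generating family of total sum zero in which each edge occurs at
most twice, then large girth bounds the number of edges. -/
theorem card_edgeFinset_lt_of_generating_family [Nonempty V] [DecidableRel G.Adj]
    {ι : Type*} [Fintype ι] [DecidableEq ι]
    {z : ι → Sym2 V → ZMod 2} (hz : ∀ i, z i ∈ G.cycleSpace) (hsum : ∑ i, z i = 0)
    (htwo : ∀ e ∈ G.edgeSet, (Finset.univ.filter fun i => z i e ≠ 0).card ≤ 2)
    (hspan : G.cycleSpace ≤ Submodule.span (ZMod 2) (Set.range z)) (hg : 10 ≤ G.egirth) :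
    4 * G.edgeFinset.card < 5 * Fintype.card V := by
  -- The girth bound applies only to nonzero members, so only these are counted.
  set J : Finset ι := Finset.univ.filter fun i => z i ≠ 0 with hJ
  have hdim := card_edgeFinset_lt_finrank_cycleSpace_add (G := G)
  have hcount : J.card * 10 ≤ G.edgeFinset.card * 2 := by
    refine Finset.card_mul_le_card_mul (fun i e => z i e ≠ 0) (fun i hi => ?_) (fun e he => ?_)
    · have hi0 : z i ≠ 0 := by simpa [hJ] using hi
      have h := hg.trans (egirth_le_card_support (hz i) hi0)
      have h' : 10 ≤ (Finset.univ.filter fun e => z i e ≠ 0).card := by exact_mod_cast h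
      refine h'.trans (Finset.card_le_card fun e he => ?_)
      simp only [Finset.mem_filter, Finset.mem_univ, true_and] at he
      simp only [Finset.bipartiteAbove, Finset.mem_filter, mem_edgeFinset]
      exact ⟨by_contra fun h => he ((mem_cycleSpace.mp (hz i)).1 e h), he⟩
    · refine (Finset.card_le_card fun i hi => ?_).trans (htwo e (by simpa using he))
      simp only [Finset.bipartiteBelow, Finset.mem_filter] at hi
      simpa using hi.2
  have hfin : ∀ s : Finset ι, (∀ i, z i ∈ Submodule.span (ZMod 2) (z '' s)) →
      Module.finrank (ZMod 2) G.cycleSpace ≤ s.card := by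
    intro s hs
    classical
    refine (Submodule.finrank_mono (hspan.trans (Submodule.span_le.mpr ?_))).trans
      (((finrank_span_finset_le_card (R := ZMod 2) (s.image z))).trans Finset.card_image_le)
    rintro _ ⟨i, rfl⟩
    simpa using hs i
  rcases J.eq_empty_or_nonempty with h0 | ⟨j, hj⟩
  · have := hfin ∅ fun i => by
      have : z i = 0 := by_contra fun h => by
        have : i ∈ J := by simpa [hJ] using h
        simp [h0] at this
      simp [this]
    rw [Finset.card_empty] at this
    have : 0 < Fintype.card V := Fintype.card_pos
    omega
  -- The zero total makes member j redundant, so the dimension is at most |J| - 1. With 5|J| ≤ m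
  -- this gives m + 2 ≤ n + m/5.
  · have hJerase : ∀ i ≠ j, z i ∈ Submodule.span (ZMod 2) (z '' (J.erase j : Finset ι)) := by
      intro i hij
      by_cases hi : z i = 0
      · rw [hi]; exact Submodule.zero_mem _
      · exact Submodule.subset_span ⟨i, by simp [hJ, hi, hij], rfl⟩
    have := hfin (J.erase j) fun i => by
      by_cases hij : i = j
      · subst hij
        rw [← Finset.add_sum_erase _ _ (Finset.mem_univ i)] at hsum
        rw [eq_neg_of_add_eq_zero_left hsum]
        exact Submodule.neg_mem _ (Submodule.sum_mem _ fun k hk =>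
          hJerase k (Finset.ne_of_mem_erase hk))
      · exact hJerase i hij
    rw [Finset.card_erase_of_mem hj] at this
    have : 0 < J.card := Finset.card_pos.mpr ⟨j, hj⟩
    omega

end CycleSpace
end SimpleGraph

/-! ### Mod 2 chains and squares in the grid -/

namespace SimpleGraph

section SquareGrid

/-- The infinite square grid. -/
def squareGrid : SimpleGraph (ℤ × ℤ) where
  Adj x y := (x.1 = y.1 ∧ (y.2 = x.2 + 1 ∨ x.2 = y.2 + 1)) ∨
    (x.2 = y.2 ∧ (y.1 = x.1 + 1 ∨ x.1 = y.1 + 1))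
  symm := ⟨fun x y h => by omega⟩
  loopless := ⟨fun x h => by omega⟩

theorem squareGrid_adj {x y : ℤ × ℤ} : squareGrid.Adj x y ↔
    (x.1 = y.1 ∧ (y.2 = x.2 + 1 ∨ x.2 = y.2 + 1)) ∨
    (x.2 = y.2 ∧ (y.1 = x.1 + 1 ∨ x.1 = y.1 + 1)) := Iff.rfl

/-- The four neighbours of a point of the square grid. -/
def gridNbrs (x : ℤ × ℤ) : Finset (ℤ × ℤ) :=
  {(x.1 + 1, x.2), (x.1 - 1, x.2), (x.1, x.2 + 1), (x.1, x.2 - 1)}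

theorem mem_gridNbrs {x y : ℤ × ℤ} : y ∈ gridNbrs x ↔ squareGrid.Adj x y := by
  simp only [gridNbrs, Finset.mem_insert, Finset.mem_singleton, squareGrid_adj, Prod.ext_iff]
  omega

theorem sum_gridNbrs (x : ℤ × ℤ) (f : ℤ × ℤ → ZMod 2) :
    ∑ y ∈ gridNbrs x, f y =
      f (x.1 + 1, x.2) + f (x.1 - 1, x.2) + f (x.1, x.2 + 1) + f (x.1, x.2 - 1) := by
  rw [gridNbrs, Finset.sum_insert, Finset.sum_insert, Finset.sum_insert, Finset.sum_singleton]
  · ring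
  all_goals
    simp only [Finset.mem_insert, Finset.mem_singleton, Prod.ext_iff]
    omega

/-- The unit square above or to the right of a grid edge. Squares are named after their lower
left corner. -/
def upperFace (x y : ℤ × ℤ) : ℤ × ℤ := (min x.1 y.1, min x.2 y.2)

/-- The unit square below or to the left of a grid edge. -/
def lowerFace (x y : ℤ × ℤ) : ℤ × ℤ :=
  if x.1 = y.1 then (min x.1 y.1 - 1, min x.2 y.2) else (min x.1 y.1, min x.2 y.2 - 1)

theorem upperFace_comm (x y : ℤ × ℤ) : upperFace x y = upperFace y x := by
  simp only [upperFace, min_comm]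

theorem lowerFace_comm (x y : ℤ × ℤ) : lowerFace x y = lowerFace y x := by
  simp only [lowerFace, min_comm, eq_comm]

/-- Each of the four squares around `x` borders exactly two of the grid edges at `x`. -/
theorem sum_gridNbrs_face (F : ℤ × ℤ → ZMod 2) (x : ℤ × ℤ) :
    ∑ y ∈ gridNbrs x, (F (upperFace x y) + F (lowerFace x y)) = 0 := by
  obtain ⟨i, j⟩ := x
  have h2 : (2 : ZMod 2) = 0 := CharTwo.two_eq_zero
  simp only [sum_gridNbrs, upperFace, lowerFace]
  have e1 : min i (i + 1) = i := by omega
  have e2 : min i (i - 1) = i - 1 := by omega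
  have e3 : min j (j + 1) = j := by omega
  have e4 : min j (j - 1) = j - 1 := by omega
  have n1 : i ≠ i + 1 := by omega
  have n2 : i ≠ i - 1 := by omega
  simp only [e1, e2, e3, e4, n1, n2, min_self, if_true, if_false]
  linear_combination (F (i, j) + F (i, j - 1) + F (i - 1, j) + F (i - 1, j - 1)) * h2

theorem exists_antiderivative (g : ℤ → ZMod 2) : ∃ f : ℤ → ZMod 2, ∀ i, f i = f (i - 1) + g i := by
  refine ⟨fun i => ∑ k ∈ Finset.range i.toNat, g (k + 1) +
    ∑ k ∈ Finset.range (-i).toNat, g (-k), fun i => ?_⟩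
  rcases lt_or_ge 0 i with hi | hi
  · obtain ⟨n, rfl⟩ : ∃ n : ℕ, i = n + 1 := ⟨(i - 1).toNat, by omega⟩
    have e1 : ((n : ℤ) + 1).toNat = n + 1 := by omega
    have e2 : ((n : ℤ) + 1 - 1).toNat = n := by omega
    have e3 : (-((n : ℤ) + 1)).toNat = 0 := by omega
    have e4 : (-((n : ℤ) + 1 - 1)).toNat = 0 := by omega
    simp only [e1, e2, e3, e4, Finset.sum_range_succ, Finset.range_zero, Finset.sum_empty, add_zero]
  · obtain ⟨n, rfl⟩ : ∃ n : ℕ, i = -n := ⟨(-i).toNat, by omega⟩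
    have e1 : (-(n : ℤ)).toNat = 0 := by omega
    have e2 : (-(n : ℤ) - 1).toNat = 0 := by omega
    have e3 : (- -(n : ℤ)).toNat = n := by omega
    have e4 : (-(-(n : ℤ) - 1)).toNat = n + 1 := by omega
    simp only [e1, e2, e3, e4, Finset.sum_range_succ, Finset.range_zero, Finset.sum_empty, zero_add]
    rw [add_assoc, CharTwo.add_self_eq_zero, add_zero]

/-- Every closed function on the edges of the square grid is the coboundary of a function on its
squares. -/
theorem exists_face_potential (c : ℤ × ℤ → ℤ × ℤ → ZMod 2) (hs : ∀ x y, c x y = c y x)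
    (hc : ∀ x, ∑ y ∈ gridNbrs x, c x y = 0) :
    ∃ F : ℤ × ℤ → ZMod 2, ∀ x y, squareGrid.Adj x y →
      c x y = F (upperFace x y) + F (lowerFace x y) := by
  have h2 : (2 : ZMod 2) = 0 := CharTwo.two_eq_zero
  -- Integrating the vertical edges along row j of squares determines the potential on that row up
  -- to a constant, `k j`. The constants are fixed by the horizontal edges from column 0 to column
  -- 1.
  choose f hf using fun j => exists_antiderivative fun i => c (i, j) (i, j + 1)
  obtain ⟨k, hk⟩ := exists_antiderivative fun j => c (0, j) (1, j) + f j 0 + f (j - 1) 0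
  have hcl : ∀ i j, c (i, j) (i + 1, j) + c (i - 1, j) (i, j) + c (i, j) (i, j + 1) +
      c (i, j - 1) (i, j) = 0 := by
    intro i j
    have := hc (i, j)
    rw [sum_gridNbrs] at this
    simpa only [hs (i, j) (i - 1, j), hs (i, j) (i, j - 1)] using this
  have hV : ∀ i j, c (i, j) (i, j + 1) = (f j i + k j) + (f j (i - 1) + k j) := by
    intro i j
    linear_combination (- k j - f j (i - 1)) * h2 - hf j i
  have hH : ∀ i j, c (i, j) (i + 1, j) + ((f j i + k j) + (f (j - 1) i + k (j - 1))) = 0 := by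
    -- The error on horizontal edges does not change along a row, because `c` is closed at the
    -- vertex (i, j).
    have hstep : ∀ i j, c (i, j) (i + 1, j) + ((f j i + k j) + (f (j - 1) i + k (j - 1))) =
        c (i - 1, j) (i, j) + ((f j (i - 1) + k j) + (f (j - 1) (i - 1) + k (j - 1))) := by
      intro i j
      have h1 := hf j i
      have h3 := hf (j - 1) i
      rw [sub_add_cancel] at h3
      linear_combination hcl i j + h1 + h3 - c (i - 1, j) (i, j) * h2
    intro i j
    induction i using Int.induction_on with
    | zero =>
      rw [zero_add]
      linear_combination (c (0, j) (1, j) + f j 0 + f (j - 1) 0 + k (j - 1)) * h2 + hk j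
    | succ n ih =>
      rw [hstep, add_sub_cancel_right]
      exact ih
    | pred n ih =>
      rw [hstep] at ih
      rw [sub_add_cancel]
      exact ih
  refine ⟨fun p => f p.2 p.1 + k p.2, fun x y hxy => ?_⟩
  have main : ∀ x y : ℤ × ℤ, (x.1 = y.1 ∧ y.2 = x.2 + 1) ∨ (x.2 = y.2 ∧ y.1 = x.1 + 1) →
      c x y = (f (upperFace x y).2 (upperFace x y).1 + k (upperFace x y).2) +
        (f (lowerFace x y).2 (lowerFace x y).1 + k (lowerFace x y).2) := by
    rintro ⟨i, j⟩ ⟨i', j'⟩ (⟨h, h'⟩ | ⟨h, h'⟩)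
    · dsimp only at h h'
      subst h h'
      have e3 : min j (j + 1) = j := by omega
      simp only [upperFace, lowerFace, min_self, e3, if_true]
      exact hV i j
    · dsimp only at h h'
      subst h h'
      have e3 : min i (i + 1) = i := by omega
      have n1 : i ≠ i + 1 := by omega
      simp only [upperFace, lowerFace, min_self, e3, n1, if_false]
      exact CharTwo.add_eq_zero.mp (hH i j)
  rw [squareGrid_adj] at hxy
  by_cases h : (x.1 = y.1 ∧ y.2 = x.2 + 1) ∨ (x.2 = y.2 ∧ y.1 = x.1 + 1)
  · exact main x y h
  · rw [hs, upperFace_comm, lowerFace_comm]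
    exact main y x (by omega)

/-- Two grid points joined by a path inside `S` bound a chain supported in `S`. -/
theorem exists_chain_of_reflTransGen {S : Finset (ℤ × ℤ)} {a b : ℤ × ℤ}
    (h : Relation.ReflTransGen (fun x y => squareGrid.Adj x y ∧ x ∈ S ∧ y ∈ S) a b) :
    ∃ c : ℤ × ℤ → ℤ × ℤ → ZMod 2, (∀ x y, c x y = c y x) ∧
      (∀ x y, ¬ (x ∈ S ∧ y ∈ S) → c x y = 0) ∧
      ∀ x, ∑ y ∈ gridNbrs x, c x y = (if x = a then 1 else 0) + if x = b then 1 else 0 := by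
  induction h with
  | refl =>
    refine ⟨fun _ _ => 0, fun _ _ => rfl, fun _ _ _ => rfl, fun x => ?_⟩
    simp [CharTwo.add_self_eq_zero]
  | @tail b d _ hbd ih =>
    obtain ⟨c, hs, h0, hc⟩ := ih
    obtain ⟨hadj, hb, hd⟩ := hbd
    refine ⟨fun x y => c x y + ((if x = b ∧ y = d then 1 else 0) + if x = d ∧ y = b then 1 else 0),
      fun x y => ?_, fun x y hxy => ?_, fun x => ?_⟩
    · simp only [hs x y, and_comm (a := y = _)]
      rw [add_comm (ite _ _ _)]
    · have h1 : ¬ (x = b ∧ y = d) := by rintro ⟨rfl, rfl⟩; exact hxy ⟨hb, hd⟩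
      have h2 : ¬ (x = d ∧ y = b) := by rintro ⟨rfl, rfl⟩; exact hxy ⟨hd, hb⟩
      simp [h0 x y hxy, h1, h2]
    · have key : ∀ p q : ℤ × ℤ, squareGrid.Adj p q →
          ∑ y ∈ gridNbrs x, (if x = p ∧ y = q then (1 : ZMod 2) else 0) = if x = p then 1 else 0 := by
        intro p q hpq
        by_cases hx : x = p
        · subst hx
          simp [mem_gridNbrs, hpq]
        · simp [hx]
      rw [Finset.sum_add_distrib, Finset.sum_add_distrib, hc, key b d hadj, key d b hadj.symm]
      have h2 : (2 : ZMod 2) = 0 := CharTwo.two_eq_zero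
      linear_combination (if x = b then (1 : ZMod 2) else 0) * h2

end SquareGrid
end SimpleGraph

/-! ### Grid minor models and their faces -/

namespace SimpleGraph

section GridMinor

variable {V : Type*}

/-- A model of `G` as a minor of the square grid: disjoint connected finite branch sets, and for
each edge of `G` a grid edge joining the branch sets of its ends. -/
structure GridMinorModel (G : SimpleGraph V) where
  /-- the branch sets -/
  branch : V → Finset (ℤ × ℤ)
  /-- the end in `branch u` of the grid edge for `s(u, v)` -/
  port : V → V → ℤ × ℤ
  eq_of_mem_branch : ∀ {u v x}, x ∈ branch u → x ∈ branch v → u = v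
  connected : ∀ v, ∀ x ∈ branch v, ∀ y ∈ branch v,
    Relation.ReflTransGen (fun x y => squareGrid.Adj x y ∧ x ∈ branch v ∧ y ∈ branch v) x y
  port_mem : ∀ {u v}, G.Adj u v → port u v ∈ branch u
  port_adj : ∀ {u v}, G.Adj u v → squareGrid.Adj (port u v) (port v u)

namespace GridMinorModel

variable {G : SimpleGraph V} (M : GridMinorModel G)

/-- The grid edges used by the model. -/
def Used (x y : ℤ × ℤ) : Prop :=
  (∃ v, x ∈ M.branch v ∧ y ∈ M.branch v) ∨
    ∃ u v, G.Adj u v ∧ x = M.port u v ∧ y = M.port v u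

/-- The grid squares, with squares identified across unused grid edges. -/
def Face : Type :=
  Quot fun p q : ℤ × ℤ => ∃ x y, squareGrid.Adj x y ∧ ¬ M.Used x y ∧
    p = upperFace x y ∧ q = lowerFace x y

/-- The face containing a square. -/
def face (p : ℤ × ℤ) : M.Face := Quot.mk _ p

theorem face_eq {x y : ℤ × ℤ} (h : squareGrid.Adj x y) (hu : ¬ M.Used x y) :
    M.face (upperFace x y) = M.face (lowerFace x y) :=
  Quot.sound ⟨x, y, h, hu, rfl, rfl⟩

theorem port_injective {u v u' v' : V} (h : G.Adj u v) (h' : G.Adj u' v')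
    (h1 : M.port u v = M.port u' v') (h2 : M.port v u = M.port v' u') : u = u' ∧ v = v' :=
  ⟨M.eq_of_mem_branch (M.port_mem h) (h1 ▸ M.port_mem h'),
    M.eq_of_mem_branch (M.port_mem h.symm) (h2 ▸ M.port_mem h'.symm)⟩

open Classical in
-- Adding closedness over the branch set of `v` cancels its inner edges; among the edges leaving it,
-- `c` can be nonzero only on port edges.
theorem sum_port_eq_zero [Fintype V] (c : ℤ × ℤ → ℤ × ℤ → ZMod 2) (hs : ∀ x y, c x y = c y x)
    (hc : ∀ x, ∑ y ∈ gridNbrs x, c x y = 0)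
    (h0 : ∀ x y, squareGrid.Adj x y → ¬ M.Used x y → c x y = 0) (v : V) :
    ∑ w, (if G.Adj v w then c (M.port v w) (M.port w v) else 0) = 0 := by
  set S := M.branch v
  have h1 : ∑ x ∈ S, ∑ y ∈ S, (if squareGrid.Adj x y then c x y else 0) = 0 :=
    sum_sum_eq_zero_of_symm S _ (fun x y => by rw [hs, squareGrid.adj_comm]) fun x => by simp
  have h2 : ∑ x ∈ S, ∑ y ∈ gridNbrs x with y ∈ S, c x y = 0 := by
    rw [← h1]
    refine Finset.sum_congr rfl fun x _ => ?_
    rw [← Finset.sum_filter]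
    refine Finset.sum_congr ?_ fun _ _ => rfl
    ext y
    simp [mem_gridNbrs, and_comm]
  have h3 : ∑ x ∈ S, ∑ y ∈ gridNbrs x with y ∉ S, c x y = 0 := by
    have : ∑ x ∈ S, ∑ y ∈ gridNbrs x, c x y = 0 := Finset.sum_eq_zero fun x _ => hc x
    simpa only [← Finset.sum_filter_add_sum_filter_not (gridNbrs _) (· ∈ S),
      Finset.sum_add_distrib, h2, zero_add] using this
  refine Eq.trans ?_ h3
  rw [Finset.sum_sigma', ← Finset.sum_filter]
  refine Finset.sum_of_injOn (fun w => (⟨M.port v w, M.port w v⟩ : Σ _ : ℤ × ℤ, ℤ × ℤ))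
    ?_ ?_ ?_ fun _ _ => rfl
  · intro w hw w' hw' h
    simp only [Finset.coe_filter, Finset.mem_univ, true_and] at hw hw'
    have h' : M.port w v = M.port w' v := by
      simpa using congrArg Sigma.snd h
    exact M.eq_of_mem_branch (M.port_mem (Adj.symm hw)) (h' ▸ M.port_mem (Adj.symm hw'))
  · intro w hw
    simp only [Finset.coe_filter, Finset.mem_univ, true_and] at hw
    replace hw : G.Adj v w := hw
    simp only [Finset.coe_sigma, Set.mem_sigma_iff, Finset.mem_coe, Finset.mem_filter,
      mem_gridNbrs]
    exact ⟨M.port_mem hw, M.port_adj hw,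
      fun h => hw.ne (M.eq_of_mem_branch h (M.port_mem hw.symm))⟩
  · rintro ⟨x, y⟩ hxy hne
    simp only [Finset.mem_sigma, Finset.mem_filter, mem_gridNbrs] at hxy
    refine h0 x y hxy.2.1 ?_
    rintro (⟨u, hx, hy⟩ | ⟨u, w, hw, rfl, rfl⟩)
    · obtain rfl := M.eq_of_mem_branch hx hxy.1
      exact hxy.2.2 hy
    · obtain rfl := M.eq_of_mem_branch (M.port_mem hw) hxy.1
      exact hne ⟨w, by simpa using hw, rfl⟩

open Classical in
/-- Each element of the cycle space of `G` is induced by a closed function on the grid that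
vanishes on unused edges. -/
theorem exists_lift [Fintype V] {z : Sym2 V → ZMod 2} (hz : z ∈ G.cycleSpace) :
    ∃ c : ℤ × ℤ → ℤ × ℤ → ZMod 2, (∀ x y, c x y = c y x) ∧
      (∀ x, ∑ y ∈ gridNbrs x, c x y = 0) ∧
      (∀ x y, squareGrid.Adj x y → ¬ M.Used x y → c x y = 0) ∧
      ∀ u v, G.Adj u v → c (M.port u v) (M.port v u) = z s(u, v) := by
  obtain ⟨hzE, hzV⟩ := mem_cycleSpace.mp hz
  have hz0 : ∀ u v, ¬ G.Adj u v → z s(u, v) = 0 := fun u v h => hzE _ h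
  have hroot : ∀ v, ∃ r : ℤ × ℤ, ∀ x ∈ M.branch v, ∃ c : ℤ × ℤ → ℤ × ℤ → ZMod 2,
      (∀ x y, c x y = c y x) ∧ (∀ x y, ¬ (x ∈ M.branch v ∧ y ∈ M.branch v) → c x y = 0) ∧
      ∀ t, ∑ y ∈ gridNbrs t, c t y = (if t = x then 1 else 0) + if t = r then 1 else 0 := by
    intro v
    rcases (M.branch v).eq_empty_or_nonempty with h | ⟨r, hr⟩
    · exact ⟨0, by simp [h]⟩
    · exact ⟨r, fun x hx => exists_chain_of_reflTransGen (M.connected v x hx r hr)⟩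
  choose r hr using hroot
  choose K hKs hK0 hKb using hr
  let k : V → V → ℤ × ℤ → ℤ × ℤ → ZMod 2 := fun u v =>
    if h : G.Adj u v then K u (M.port u v) (M.port_mem h) else 0
  have hks : ∀ u v x y, k u v x y = k u v y x := by
    intro u v x y
    by_cases h : G.Adj u v
    · simp only [k, dif_pos h]; exact hKs _ _ _ _ _
    · simp only [k, dif_neg h]; rfl
  have hk0 : ∀ u v x y, ¬ (x ∈ M.branch u ∧ y ∈ M.branch u) → k u v x y = 0 := by
    intro u v x y hxy
    by_cases h : G.Adj u v
    · simp only [k, dif_pos h]; exact hK0 _ _ _ _ _ hxy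
    · simp only [k, dif_neg h]; rfl
  have hkb : ∀ u v, G.Adj u v → ∀ x, ∑ y ∈ gridNbrs x, k u v x y =
      (if x = M.port u v then 1 else 0) + if x = r u then 1 else 0 := by
    intro u v h x
    simp only [k, dif_pos h]; exact hKb _ _ _ _
  let d : V → V → ℤ × ℤ → ℤ × ℤ → ZMod 2 := fun u v x y =>
    if x = M.port u v ∧ y = M.port v u then 1 else 0
  have hdb : ∀ u v, G.Adj u v → ∀ x, ∑ y ∈ gridNbrs x, d u v x y =
      if x = M.port u v then 1 else 0 := by
    intro u v h x
    by_cases hx : x = M.port u v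
    · subst hx
      simp [d, mem_gridNbrs, M.port_adj h]
    · simp [d, hx]
  -- Each port edge carries its value of `z`, which is routed inside the branch set from the port to
  -- the root `r u`. Ports cancel, and the root receives the sum of `z` around u, which is zero.
  refine ⟨fun x y => ∑ u, ∑ v, z s(u, v) * (d u v x y + k u v x y), fun x y => ?_, fun x => ?_,
    fun x y hxy hu => ?_, fun u v huv => ?_⟩
  · simp only [mul_add, Finset.sum_add_distrib]
    congr 1
    · rw [Finset.sum_comm]
      refine Finset.sum_congr rfl fun u _ => Finset.sum_congr rfl fun v _ => ?_
      simp only [d, Sym2.eq_swap (a := v), and_comm]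
    · exact Finset.sum_congr rfl fun u _ => Finset.sum_congr rfl fun v _ => by rw [hks]
  · rw [Finset.sum_comm]
    refine Finset.sum_eq_zero fun u _ => ?_
    rw [Finset.sum_comm]
    have : ∀ v, ∑ y ∈ gridNbrs x, z s(u, v) * (d u v x y + k u v x y) =
        z s(u, v) * if x = r u then 1 else 0 := by
      intro v
      by_cases h : G.Adj u v
      · rw [← Finset.mul_sum, Finset.sum_add_distrib, hdb u v h, hkb u v h, ← add_assoc,
          CharTwo.add_self_eq_zero, zero_add]
      · simp [hz0 u v h]
    simp only [this, ← Finset.sum_mul, hzV, zero_mul]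
  · refine Finset.sum_eq_zero fun u _ => Finset.sum_eq_zero fun v _ => ?_
    by_cases h : G.Adj u v
    · have h1 : d u v x y = 0 := if_neg fun h' => hu (Or.inr ⟨u, v, h, h'⟩)
      have h2 : k u v x y = 0 := hk0 _ _ _ _ fun h' => hu (Or.inl ⟨u, h'⟩)
      rw [h1, h2, add_zero, mul_zero]
    · rw [hz0 u v h, zero_mul]
  · have h2 : ∀ u' v', k u' v' (M.port u v) (M.port v u) = 0 := fun u' v' =>
      hk0 _ _ _ _ fun h' => huv.ne ((M.eq_of_mem_branch (M.port_mem huv) h'.1).trans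
        (M.eq_of_mem_branch h'.2 (M.port_mem huv.symm)))
    have h1 : ∀ u' v', ¬ (u' = u ∧ v' = v) →
        z s(u', v') * d u' v' (M.port u v) (M.port v u) = 0 := by
      intro u' v' hne
      by_cases h : G.Adj u' v'
      · have : d u' v' (M.port u v) (M.port v u) = 0 := if_neg fun h' =>
          hne (M.port_injective h huv h'.1.symm h'.2.symm)
        rw [this, mul_zero]
      · rw [hz0 u' v' h, zero_mul]
    simp only [h2, add_zero]
    rw [Finset.sum_eq_single_of_mem u (Finset.mem_univ u),
      Finset.sum_eq_single_of_mem v (Finset.mem_univ v)]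
    · simp [d]
    · exact fun v' _ hne => h1 u v' fun h => hne h.2
    · exact fun u' _ hne => Finset.sum_eq_zero fun v' _ => h1 u' v' fun h => hne h.1

open Classical in
/-- The boundary of a face, as an element of the cycle space. -/
noncomputable def boundary (κ : M.Face) : Sym2 V → ZMod 2 :=
  Sym2.lift ⟨fun u v => if G.Adj u v then
      (if M.face (upperFace (M.port u v) (M.port v u)) = κ then 1 else 0) +
        (if M.face (lowerFace (M.port u v) (M.port v u)) = κ then 1 else 0) else 0,
    fun u v => by
      simp only [upperFace_comm (M.port u v), lowerFace_comm (M.port u v), G.adj_comm u v]⟩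

open Classical in
theorem boundary_mk (κ : M.Face) {u v : V} (h : G.Adj u v) : M.boundary κ s(u, v) =
    (if M.face (upperFace (M.port u v) (M.port v u)) = κ then 1 else 0) +
      (if M.face (lowerFace (M.port u v) (M.port v u)) = κ then 1 else 0) :=
  if_pos h

theorem boundary_mk_of_not_adj (κ : M.Face) {u v : V} (h : ¬ G.Adj u v) :
    M.boundary κ s(u, v) = 0 :=
  if_neg h

theorem boundary_mem_cycleSpace [Fintype V] (κ : M.Face) : M.boundary κ ∈ G.cycleSpace := by
  classical
  refine mem_cycleSpace.mpr ⟨fun e he => ?_, fun v => ?_⟩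
  · induction e with | h u v => exact M.boundary_mk_of_not_adj κ he
  · let F : ℤ × ℤ → ZMod 2 := fun p => if M.face p = κ then 1 else 0
    rw [← M.sum_port_eq_zero (fun x y => F (upperFace x y) + F (lowerFace x y))
      (fun x y => by rw [upperFace_comm, lowerFace_comm]) (sum_gridNbrs_face F)
      (fun x y hxy hu => by
        simp only [F, M.face_eq hxy hu, CharTwo.add_self_eq_zero]) v]
    refine Finset.sum_congr rfl fun w _ => ?_
    split_ifs with h
    · exact M.boundary_mk κ h
    · exact M.boundary_mk_of_not_adj κ h

theorem card_edgeFinset_lt [Fintype V] [DecidableEq V] [Nonempty V] [DecidableRel G.Adj]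
    (M : G.GridMinorModel) (hg : 10 ≤ G.egirth) : 4 * G.edgeFinset.card < 5 * Fintype.card V := by
  classical
  let a : V → V → M.Face := fun u v => M.face (upperFace (M.port u v) (M.port v u))
  let b : V → V → M.Face := fun u v => M.face (lowerFace (M.port u v) (M.port v u))
  -- The faces beside port edges form a finite set; all other faces have zero boundary.
  let I : Finset M.Face := Finset.univ.biUnion fun u => Finset.univ.biUnion fun v => {a u v, b u v}
  have haI : ∀ u v, a u v ∈ I := fun u v => by
    simp only [I, Finset.mem_biUnion]
    exact ⟨u, Finset.mem_univ _, v, Finset.mem_univ _, by simp⟩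
  have hbI : ∀ u v, b u v ∈ I := fun u v => by
    simp only [I, Finset.mem_biUnion]
    exact ⟨u, Finset.mem_univ _, v, Finset.mem_univ _, by simp⟩
  have hcomb : ∀ (F : M.Face → ZMod 2) u v, G.Adj u v →
      ∑ κ : I, F κ * M.boundary κ s(u, v) = F (a u v) + F (b u v) := by
    intro F u v h
    rw [Finset.sum_coe_sort I fun κ => F κ * M.boundary κ s(u, v)]
    simp only [M.boundary_mk _ h, mul_add, Finset.sum_add_distrib, mul_ite, mul_one, mul_zero]
    rw [Finset.sum_ite_eq, Finset.sum_ite_eq, if_pos (haI u v), if_pos (hbI u v)]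
  refine card_edgeFinset_lt_of_generating_family (z := fun κ : I => M.boundary κ)
    (fun κ => M.boundary_mem_cycleSpace κ) ?_ ?_ ?_ hg
  · funext e
    induction e with | h u v =>
    rw [Finset.sum_apply, Pi.zero_apply]
    by_cases h : G.Adj u v
    · simpa [CharTwo.add_self_eq_zero] using hcomb (fun _ => 1) u v h
    · exact Finset.sum_eq_zero fun κ _ => M.boundary_mk_of_not_adj κ h
  · intro e he
    induction e with | h u v =>
    refine (Finset.card_le_card (t := {⟨a u v, haI u v⟩, ⟨b u v, hbI u v⟩}) fun κ hκ => ?_).trans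
      Finset.card_le_two
    simp only [Finset.mem_filter, Finset.mem_univ, true_and, M.boundary_mk _ he] at hκ
    simp only [Finset.mem_insert, Finset.mem_singleton, Subtype.ext_iff]
    by_contra! hne
    exact hκ (by rw [if_neg hne.1.symm, if_neg hne.2.symm, add_zero])
  · intro z hz
    obtain ⟨c, hs, hc, h0, hcz⟩ := M.exists_lift hz
    obtain ⟨F, hF⟩ := exists_face_potential c hs hc
    -- The lift vanishes on unused edges, so its potential agrees on squares that are identified.
    -- Its values on faces are the coefficients of `z`.
    let F' : M.Face → ZMod 2 := Quot.lift F (by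
      rintro _ _ ⟨x, y, hxy, hu, rfl, rfl⟩
      exact CharTwo.add_eq_zero.mp ((hF x y hxy).symm.trans (h0 x y hxy hu)))
    have : z = ∑ κ : I, F' κ • M.boundary κ := by
      funext e
      induction e with | h u v =>
      rw [Finset.sum_apply]
      simp only [Pi.smul_apply, smul_eq_mul]
      by_cases h : G.Adj u v
      · rw [hcomb F' u v h, ← hcz u v h, hF _ _ (M.port_adj h)]
        rfl
      · rw [(mem_cycleSpace.mp hz).1 _ h]
        exact (Finset.sum_eq_zero fun κ _ => by
          rw [M.boundary_mk_of_not_adj κ h, mul_zero]).symm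
    rw [this]
    exact Submodule.sum_mem _ fun κ _ => Submodule.smul_mem _ _ (Submodule.subset_span ⟨κ, rfl⟩)

end GridMinorModel
end GridMinor
end SimpleGraph

/-! ### Approximating plane sets by grid points -/

section Discretization

open SimpleGraph (squareGrid squareGrid_adj)

/-- The point of the plane with grid coordinates `x` in the grid of mesh `ε`. -/
def gridPoint (ε : ℝ) (x : ℤ × ℤ) : ℝ × ℝ := (ε * x.1, ε * x.2)

/-- The grid coordinates of the lower left corner of the square of mesh `ε` containing `p`. -/
noncomputable def gridFloor (ε : ℝ) (p : ℝ × ℝ) : ℤ × ℤ := (⌊p.1 / ε⌋, ⌊p.2 / ε⌋)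

variable {ε : ℝ}

theorem dist_gridPoint_le_iff {x : ℤ × ℤ} {P : ℝ × ℝ} {ρ : ℝ} :
    dist (gridPoint ε x) P ≤ ρ ↔ |ε * x.1 - P.1| ≤ ρ ∧ |ε * x.2 - P.2| ≤ ρ := by
  rw [Prod.dist_eq, max_le_iff, Real.dist_eq, Real.dist_eq]
  rfl

theorem dist_gridPoint_gridFloor (hε : 0 < ε) (p : ℝ × ℝ) :
    dist (gridPoint ε (gridFloor ε p)) p ≤ ε := by
  have key : ∀ t : ℝ, |ε * (⌊t / ε⌋ : ℤ) - t| ≤ ε := by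
    intro t
    have h1 := mul_le_mul_of_nonneg_left (Int.floor_le (t / ε)) hε.le
    have h2 := mul_le_mul_of_nonneg_left (Int.lt_floor_add_one (t / ε)).le hε.le
    rw [mul_div_cancel₀ _ hε.ne'] at h1 h2
    rw [abs_le]
    constructor <;> linarith
  exact dist_gridPoint_le_iff.mpr ⟨key _, key _⟩

theorem reflTransGen_squareGrid_of_box {S : Set (ℤ × ℤ)} {x y : ℤ × ℤ}
    (h : ∀ i ∈ Set.uIcc x.1 y.1, ∀ j ∈ Set.uIcc x.2 y.2, (i, j) ∈ S) :
    Relation.ReflTransGen (fun x y => squareGrid.Adj x y ∧ x ∈ S ∧ y ∈ S) x y := by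
  refine Relation.ReflTransGen.trans (b := (y.1, x.2)) ?_ ?_
  · have : Relation.ReflTransGen (fun i j => squareGrid.Adj (i, x.2) (j, x.2) ∧
        (i, x.2) ∈ S ∧ (j, x.2) ∈ S) x.1 y.1 := by
      refine reflTransGen_of_succ _ (fun i hi => ?_) fun i hi => ?_
      all_goals
        rw [Set.mem_Ico] at hi
        rw [Order.succ_eq_add_one]
        refine ⟨squareGrid_adj.mpr (by simp), h _ ?_ _ Set.left_mem_uIcc,
          h _ ?_ _ Set.left_mem_uIcc⟩ <;> rw [Set.mem_uIcc] <;> omega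
    exact this.lift (fun i => (i, x.2)) fun _ _ h => h
  · have : Relation.ReflTransGen (fun i j => squareGrid.Adj (y.1, i) (y.1, j) ∧
        (y.1, i) ∈ S ∧ (y.1, j) ∈ S) x.2 y.2 := by
      refine reflTransGen_of_succ _ (fun i hi => ?_) fun i hi => ?_
      all_goals
        rw [Set.mem_Ico] at hi
        rw [Order.succ_eq_add_one]
        refine ⟨squareGrid_adj.mpr (by simp), h _ Set.right_mem_uIcc _ ?_,
          h _ Set.right_mem_uIcc _ ?_⟩ <;> rw [Set.mem_uIcc] <;> omega
    exact this.lift (fun i => (y.1, i)) fun _ _ h => h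

theorem reflTransGen_squareGrid_of_closedBall (hε : 0 < ε) {P : ℝ × ℝ} {ρ : ℝ} {x y : ℤ × ℤ}
    (hx : dist (gridPoint ε x) P ≤ ρ) (hy : dist (gridPoint ε y) P ≤ ρ) :
    Relation.ReflTransGen (fun x y => squareGrid.Adj x y ∧
      x ∈ {x | dist (gridPoint ε x) P ≤ ρ} ∧ y ∈ {x | dist (gridPoint ε x) P ≤ ρ}) x y := by
  rw [dist_gridPoint_le_iff] at hx hy
  have key : ∀ (a b i : ℤ) (t : ℝ), |ε * a - t| ≤ ρ → |ε * b - t| ≤ ρ → i ∈ Set.uIcc a b →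
      |ε * i - t| ≤ ρ := by
    intro a b i t ha hb hi
    rw [abs_le] at *
    rcases Set.mem_uIcc.mp hi with ⟨h1, h2⟩ | ⟨h1, h2⟩
    all_goals
      have h1' := mul_le_mul_of_nonneg_left (Int.cast_le (R := ℝ).mpr h1) hε.le
      have h2' := mul_le_mul_of_nonneg_left (Int.cast_le (R := ℝ).mpr h2) hε.le
      constructor <;> linarith
  exact reflTransGen_squareGrid_of_box fun i hi j hj =>
    dist_gridPoint_le_iff.mpr ⟨key _ _ _ _ hx.1 hy.1 hi, key _ _ _ _ hx.2 hy.2 hj⟩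

/-- Being joined is a local property: if q is within ε of p, the grid points of both lie within 2ε
of p, in a sup-metric ball, which is a box and hence grid connected. -/
theorem reflTransGen_squareGrid_of_isPreconnected (hε : 0 < ε) {A : Set (ℝ × ℝ)}
    (hA : IsPreconnected A) {p q : ℝ × ℝ} (hp : p ∈ A) (hq : q ∈ A) :
    Relation.ReflTransGen (fun x y => squareGrid.Adj x y ∧
      x ∈ {x | ∃ p ∈ A, dist (gridPoint ε x) p ≤ 2 * ε} ∧
      y ∈ {x | ∃ p ∈ A, dist (gridPoint ε x) p ≤ 2 * ε}) (gridFloor ε p) (gridFloor ε q) := by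
  refine hA.induction₂ (fun p q => Relation.ReflTransGen (fun x y => squareGrid.Adj x y ∧
      x ∈ {x | ∃ p ∈ A, dist (gridPoint ε x) p ≤ 2 * ε} ∧
      y ∈ {x | ∃ p ∈ A, dist (gridPoint ε x) p ≤ 2 * ε}) (gridFloor ε p) (gridFloor ε q))
    (fun p hp => ?_) (fun _ _ _ _ _ _ h h' => h.trans h') (fun p q _ _ h => ?_) hp hq
  · have : ∀ᶠ q in nhdsWithin p A, dist q p < ε :=
      nhdsWithin_le_nhds (Metric.ball_mem_nhds p hε)
    filter_upwards [this] with q hq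
    have h1 := dist_gridPoint_gridFloor hε p
    have h2 := dist_gridPoint_gridFloor hε q
    have h3 := dist_triangle (gridPoint ε (gridFloor ε q)) q p
    have h4 : dist (gridPoint ε (gridFloor ε p)) p ≤ 2 * ε := by linarith
    have h5 : dist (gridPoint ε (gridFloor ε q)) p ≤ 2 * ε := by linarith
    exact (reflTransGen_squareGrid_of_closedBall hε h4 h5).lift id
      fun _ _ h => ⟨h.1, ⟨p, hp, h.2.1⟩, ⟨p, hp, h.2.2⟩⟩
  · exact (Relation.reflTransGen_swap.mpr h).lift id fun _ _ h => ⟨h.1.symm, h.2.2, h.2.1⟩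

theorem finite_gridPoint_mem (hε : 0 < ε) {S : Set (ℝ × ℝ)} (hS : Bornology.IsBounded S) :
    {x | gridPoint ε x ∈ S}.Finite := by
  obtain ⟨R, hR⟩ := hS.subset_closedBall 0
  refine (Set.finite_Icc ((-⌈R / ε⌉, -⌈R / ε⌉) : ℤ × ℤ) (⌈R / ε⌉, ⌈R / ε⌉)).subset fun x hx => ?_
  have h := dist_gridPoint_le_iff.mp (Metric.mem_closedBall.mp (hR hx))
  have key : ∀ i : ℤ, |ε * i - 0| ≤ R → -⌈R / ε⌉ ≤ i ∧ i ≤ ⌈R / ε⌉ := by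
    intro i hi
    rw [sub_zero, abs_mul, abs_of_pos hε, ← le_div_iff₀' hε] at hi
    have h1 : ((|i| : ℤ) : ℝ) ≤ (⌈R / ε⌉ : ℤ) := by
      rw [Int.cast_abs]
      exact hi.trans (Int.le_ceil _)
    exact abs_le.mp (Int.cast_le.mp h1)
  have h1 := key _ h.1
  have h2 := key _ h.2
  exact ⟨⟨h1.1, h2.1⟩, ⟨h1.2, h2.2⟩⟩

theorem exists_rel_of_reflTransGen {α : Type*} {R : α → α → Prop} {a b : α} {C : Set α}
    (h : Relation.ReflTransGen R a b) (ha : a ∈ C) (hb : b ∉ C) :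
    ∃ x ∈ C, ∃ y ∉ C, R x y := by
  induction h with
  | refl => exact absurd ha hb
  | @tail c d _ hcd ih =>
    by_cases hc : c ∈ C
    · exact ⟨c, hc, d, hb, hcd⟩
    · exact ih hc

end Discretization

namespace SimpleGraph

/-- Both orientations of an edge must use the same grid edge, so an ordering of the vertices decides
which choice is kept. -/
theorem GridMinorModel.nonempty_of_branch {V : Type*} [Fintype V] {G : SimpleGraph V}
    {C : V → Set (ℤ × ℤ)} (hfin : ∀ v, (C v).Finite)
    (hdisj : ∀ u v x, x ∈ C u → x ∈ C v → u = v)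
    (hconn : ∀ v, ∀ x ∈ C v, ∀ y ∈ C v,
      Relation.ReflTransGen (fun x y => squareGrid.Adj x y ∧ x ∈ C v ∧ y ∈ C v) x y)
    (hport : ∀ u v, G.Adj u v → ∃ x y, x ∈ C u ∧ y ∈ C v ∧ squareGrid.Adj x y) :
    Nonempty G.GridMinorModel := by
  have hport' : ∀ u v, ∃ x y, G.Adj u v → x ∈ C u ∧ y ∈ C v ∧ squareGrid.Adj x y := by
    intro u v
    by_cases h : G.Adj u v
    · obtain ⟨x, y, hxy⟩ := hport u v h
      exact ⟨x, y, fun _ => hxy⟩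
    · exact ⟨0, 0, fun h' => absurd h' h⟩
  choose X Y hXY using hport'
  let f := Fintype.equivFin V
  let s : V → V → ℤ × ℤ := fun u v => if f u < f v then X u v else Y v u
  have hs : ∀ u v, G.Adj u v → f u < f v → s u v = X u v ∧ s v u = Y u v := by
    intro u v _ hlt
    exact ⟨if_pos hlt, if_neg hlt.not_gt⟩
  have hs' : ∀ u v, G.Adj u v → (s u v ∈ C u ∧ s v u ∈ C v) ∧ squareGrid.Adj (s u v) (s v u) := by
    intro u v h
    rcases lt_or_gt_of_ne (f.injective.ne h.ne) with hlt | hlt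
    · obtain ⟨h1, h2⟩ := hs u v h hlt
      have := hXY u v h
      rw [h1, h2]
      exact ⟨⟨this.1, this.2.1⟩, this.2.2⟩
    · obtain ⟨h1, h2⟩ := hs v u h.symm hlt
      have := hXY v u h.symm
      rw [h1, h2]
      exact ⟨⟨this.2.1, this.1⟩, this.2.2.symm⟩
  exact ⟨{
    branch := fun v => (hfin v).toFinset
    port := s
    eq_of_mem_branch := fun hu hv => hdisj _ _ _ (by simpa using hu) (by simpa using hv)
    connected := fun v x hx y hy => by
      simpa using hconn v x (by simpa using hx) y (by simpa using hy)
    port_mem := fun h => by simpa using (hs' _ _ h).1.1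
    port_adj := fun h => (hs' _ _ h).2 }⟩

end SimpleGraph

/-! ### From a drawing to a grid minor -/

section Drawing

open SimpleGraph (squareGrid)

/-- A graph with a planar drawing by compact connected sets is a minor of the square grid. -/
theorem nonempty_gridMinorModel_of_drawing {V : Type*} [Fintype V] {G : SimpleGraph V}
    (pos : V → ℝ × ℝ) (A : Sym2 V → Set (ℝ × ℝ)) (hpos : Function.Injective pos)
    (hcomp : ∀ e ∈ G.edgeSet, IsCompact (A e)) (hconn : ∀ e ∈ G.edgeSet, IsPreconnected (A e))
    (hmem : ∀ e ∈ G.edgeSet, ∀ v ∈ e, pos v ∈ A e)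
    (hmem' : ∀ e ∈ G.edgeSet, ∀ v, pos v ∈ A e → v ∈ e)
    (hdisj : ∀ e ∈ G.edgeSet, ∀ f ∈ G.edgeSet, e ≠ f → A e ∩ A f ⊆ Set.range pos) :
    Nonempty G.GridMinorModel := by
  have hsmall : ∀ (k δ : ℝ), 0 < δ → ∀ᶠ r in nhdsWithin (0 : ℝ) (Set.Ioi 0), k * r < δ := by
    intro k δ hδ
    have : Filter.Tendsto (fun r : ℝ => k * r) (nhds 0) (nhds (k * 0)) :=
      (continuous_const.mul continuous_id).tendsto 0
    rw [mul_zero] at this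
    exact nhdsWithin_le_nhds (this.eventually (gt_mem_nhds hδ))
  obtain ⟨r, hr0, hr1, hr2⟩ : ∃ r : ℝ, 0 < r ∧ (∀ u v, u ≠ v → 2 * r < dist (pos u) (pos v)) ∧
      ∀ e ∈ G.edgeSet, ∀ v, v ∉ e → ∀ p ∈ A e, 2 * r < dist p (pos v) := by
    have h1 : ∀ᶠ r in nhdsWithin (0 : ℝ) (Set.Ioi 0),
        ∀ u v, u ≠ v → 2 * r < dist (pos u) (pos v) := by
      rw [Filter.eventually_all]; intro u
      rw [Filter.eventually_all]; intro v
      by_cases huv : u = v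
      · exact Filter.Eventually.of_forall fun _ h => absurd huv h
      · filter_upwards [hsmall 2 _ (dist_pos.mpr (hpos.ne huv))] with r hr _ using hr
    have h2 : ∀ᶠ r in nhdsWithin (0 : ℝ) (Set.Ioi 0),
        ∀ e : Sym2 V, ∀ v, e ∈ G.edgeSet → v ∉ e → ∀ p ∈ A e, 2 * r < dist p (pos v) := by
      rw [Filter.eventually_all]; intro e
      rw [Filter.eventually_all]; intro v
      by_cases h : e ∈ G.edgeSet ∧ v ∉ e
      · have : (A e)ᶜ ∈ nhds (pos v) :=
          (hcomp e h.1).isClosed.isOpen_compl.mem_nhds fun h' => h.2 (hmem' e h.1 v h')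
        obtain ⟨δ, hδ, hball⟩ := Metric.mem_nhds_iff.mp this
        filter_upwards [hsmall 2 δ hδ] with r hr _ _ p hp
        exact hr.trans_le (not_lt.mp fun hlt => hball (Metric.mem_ball.mpr hlt) hp)
      · exact Filter.Eventually.of_forall fun _ he hv => absurd ⟨he, hv⟩ h
    obtain ⟨r, h0, h1, h2⟩ := (eventually_mem_nhdsWithin.and (h1.and h2)).exists
    exact ⟨r, h0, h1, fun e he v hv => h2 e v he hv⟩
  -- Away from the vertices, distinct edges are disjoint compact sets, hence a positive distance
  -- apart. The radius r/2 leaves room: a point within 2ε < r/2 of a grid point outside all boxes of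
  -- radius r avoids these balls.
  let K : Sym2 V → Set (ℝ × ℝ) := fun e => A e \ ⋃ v, Metric.ball (pos v) (r / 2)
  have hK : ∀ e ∈ G.edgeSet, IsCompact (K e) := fun e he =>
    (hcomp e he).diff (isOpen_iUnion fun _ => Metric.isOpen_ball)
  obtain ⟨ε, hε, hεr, hεK⟩ : ∃ ε : ℝ, 0 < ε ∧ 4 * ε < r ∧
      ∀ e ∈ G.edgeSet, ∀ f ∈ G.edgeSet, e ≠ f → ∀ p ∈ K e, ∀ q ∈ K f, 4 * ε < dist p q := by
    have h2 : ∀ᶠ ε in nhdsWithin (0 : ℝ) (Set.Ioi 0), ∀ e f : Sym2 V,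
        e ∈ G.edgeSet → f ∈ G.edgeSet → e ≠ f → ∀ p ∈ K e, ∀ q ∈ K f, 4 * ε < dist p q := by
      rw [Filter.eventually_all]; intro e
      rw [Filter.eventually_all]; intro f
      by_cases h : e ∈ G.edgeSet ∧ f ∈ G.edgeSet ∧ e ≠ f
      · obtain ⟨he, hf, hef⟩ := h
        have hd : Disjoint (K e) (K f) := by
          rw [Set.disjoint_left]
          rintro p ⟨hpe, hpb⟩ ⟨hpf, -⟩
          obtain ⟨v, rfl⟩ := hdisj e he f hf hef ⟨hpe, hpf⟩
          exact hpb (Set.mem_iUnion.mpr ⟨v, Metric.mem_ball_self (half_pos hr0)⟩)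
        obtain ⟨δ, hδ, hth⟩ := hd.exists_thickenings (hK e he) (hK f hf).isClosed
        filter_upwards [hsmall 4 δ hδ] with ε hlt _ _ _ p hp q hq
        refine hlt.trans_le (not_lt.mp fun hpq => Set.disjoint_left.mp hth (?_ : p ∈ _) ?_)
        · exact Metric.self_subset_thickening hδ _ hp
        · exact Metric.mem_thickening_iff.mpr ⟨q, hq, hpq⟩
      · exact Filter.Eventually.of_forall fun _ he hf hef => absurd ⟨he, hf, hef⟩ h
    obtain ⟨ε, h0, h1, h2⟩ := (eventually_mem_nhdsWithin.and ((hsmall 4 r hr0).and h2)).exists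
    exact ⟨ε, h0, h1, fun e he f hf => h2 e f he hf⟩
  let box : V → Set (ℤ × ℤ) := fun v => {x | dist (gridPoint ε x) (pos v) ≤ r}
  let N : Sym2 V → Set (ℤ × ℤ) := fun e => {x | ∃ p ∈ A e, dist (gridPoint ε x) p ≤ 2 * ε}
  -- Each edge is given to one of its ends, chosen by `Quot.out`, which absorbs the edge's
  -- neighbourhood outside all boxes. `C u` is the component of `D u` around the vertex.
  let D : V → Set (ℤ × ℤ) := fun u =>
    box u ∪ {x | ∃ e ∈ G.edgeSet, (Quot.out e).1 = u ∧ x ∈ N e ∧ ∀ v, x ∉ box v}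
  let c : V → ℤ × ℤ := fun v => gridFloor ε (pos v)
  let C : V → Set (ℤ × ℤ) := fun u =>
    {x | Relation.ReflTransGen (fun x y => squareGrid.Adj x y ∧ x ∈ D u ∧ y ∈ D u) (c u) x}
  have hcbox : ∀ v, c v ∈ box v := fun v =>
    (dist_gridPoint_gridFloor hε (pos v)).trans (by linarith)
  have hbox : ∀ u v x, x ∈ box u → x ∈ box v → u = v := by
    intro u v x hu hv
    by_contra hne
    have h1 := hr1 u v hne
    have h2 := dist_triangle_left (pos u) (pos v) (gridPoint ε x)
    simp only [box, Set.mem_ofPred_eq] at hu hv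
    linarith
  have hNbox : ∀ e ∈ G.edgeSet, ∀ v x, x ∈ N e → x ∈ box v → v ∈ e := by
    rintro e he v x ⟨p, hp, hxp⟩ hv
    by_contra hne
    have h1 := hr2 e he v hne p hp
    have h2 := dist_triangle_left p (pos v) (gridPoint ε x)
    simp only [box, Set.mem_ofPred_eq] at hv
    linarith
  have hNN : ∀ e ∈ G.edgeSet, ∀ f ∈ G.edgeSet, ∀ x, x ∈ N e → x ∈ N f → (∀ v, x ∉ box v) →
      e = f := by
    rintro e he f hf x ⟨p, hp, hxp⟩ ⟨q, hq, hxq⟩ hx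
    by_contra hne
    have hout : ∀ p, dist (gridPoint ε x) p ≤ 2 * ε → p ∉ ⋃ v, Metric.ball (pos v) (r / 2) := by
      intro p hxp hp
      obtain ⟨v, hv⟩ := Set.mem_iUnion.mp hp
      rw [Metric.mem_ball] at hv
      have h1 := hx v
      have h2 := dist_triangle (gridPoint ε x) p (pos v)
      simp only [box, Set.mem_ofPred_eq, not_le] at h1
      linarith
    have h1 := hεK e he f hf hne p ⟨hp, hout p hxp⟩ q ⟨hq, hout q hxq⟩
    have h2 := dist_triangle_left p q (gridPoint ε x)
    linarith
  have hD : ∀ u v x, x ∈ D u → x ∈ D v → u = v := by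
    rintro u v x (hu | ⟨e, he, rfl, hxe, hx⟩) (hv | ⟨f, hf, rfl, hxf, hx'⟩)
    · exact hbox u v x hu hv
    · exact absurd hu (hx' u)
    · exact absurd hv (hx v)
    · rw [hNN e he f hf x hxe hxf hx]
  have hCD : ∀ u, C u ⊆ D u := by
    intro u x hx
    rcases Relation.ReflTransGen.cases_tail hx with rfl | ⟨y, -, -, -, h⟩
    · exact Or.inl (hcbox u)
    · exact h
  have hboxC : ∀ u, box u ⊆ C u := by
    intro u x hx
    exact (reflTransGen_squareGrid_of_closedBall hε (hcbox u) hx).lift id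
      fun _ _ h => ⟨h.1, Or.inl h.2.1, Or.inl h.2.2⟩
  have hstep : ∀ u x y, x ∈ C u → y ∈ D u → squareGrid.Adj x y → y ∈ C u := by
    intro u x y hx hy hxy
    exact Relation.ReflTransGen.tail hx ⟨hxy, hCD u hx, hy⟩
  have hport : ∀ u v, G.Adj u v → (Quot.out s(u, v)).1 = u →
      ∃ x y, x ∈ C u ∧ y ∈ C v ∧ squareGrid.Adj x y := by
    intro u v huv hout
    have hpath := reflTransGen_squareGrid_of_isPreconnected hε (hconn s(u, v) huv)
      (hmem _ huv u (Sym2.mem_mk_left u v)) (hmem _ huv v (Sym2.mem_mk_right u v))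
    have hcv : c v ∉ C u := fun h => huv.ne (hD u v _ (hCD u h) (Or.inl (hcbox v)))
    -- A grid path along the edge must leave `C u`. The exit point y is not in `D u`, so it lies in
    -- a box, and only the box of v is possible.
    obtain ⟨x, hx, y, hy, hxy, -, hyN⟩ :=
      exists_rel_of_reflTransGen hpath (hboxC u (hcbox u)) hcv
    refine ⟨x, y, hx, ?_, hxy⟩
    have hyD : y ∉ D u := fun h => hy (hstep u x y hx h hxy)
    obtain ⟨w, hw⟩ : ∃ w, y ∈ box w := by
      by_contra! h
      exact hyD (Or.inr ⟨s(u, v), huv, hout, hyN, h⟩)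
    rcases Sym2.mem_iff.mp (hNbox _ huv w y hyN hw) with rfl | rfl
    · exact absurd (Or.inl hw) hyD
    · exact hboxC w hw
  refine SimpleGraph.GridMinorModel.nonempty_of_branch (C := C) (fun u => ?_)
    (fun u v x hu hv => hD u v x (hCD u hu) (hCD v hv)) (fun u x hx y hy => ?_) fun u v huv => ?_
  · have hb : Bornology.IsBounded (Metric.closedBall (pos u) r ∪
        ⋃ e ∈ G.edgeSet, Metric.cthickening (2 * ε) (A e)) :=
      Metric.isBounded_closedBall.union ((Bornology.isBounded_biUnion (Set.toFinite _)).mpr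
        fun e he => (hcomp e he).isBounded.cthickening)
    refine (finite_gridPoint_mem hε hb).subset fun x hx => ?_
    rcases hCD u hx with h | ⟨e, he, -, ⟨p, hp, hxp⟩, -⟩
    · exact Or.inl h
    · exact Or.inr (Set.mem_biUnion he (Metric.mem_cthickening_of_dist_le _ p _ _ hp hxp))
  · have hroot : ∀ x ∈ C u, Relation.ReflTransGen
        (fun x y => squareGrid.Adj x y ∧ x ∈ C u ∧ y ∈ C u) (c u) x := by
      intro x hx
      induction hx with
      | refl => exact .refl
      | @tail y z hy hyz ih =>
        exact ih.tail ⟨hyz.1, hy, Relation.ReflTransGen.tail hy hyz⟩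
    exact Relation.ReflTransGen.trans ((Relation.reflTransGen_swap.mpr (hroot x hx)).lift id
      fun _ _ h => ⟨h.1.symm, h.2.2, h.2.1⟩) (hroot y hy)
  · have hmem_out : (Quot.out s(u, v)).1 ∈ s(u, v) := Sym2.out_fst_mem _
    rcases Sym2.mem_iff.mp hmem_out with h | h
    · exact hport u v huv h
    · rw [Sym2.eq_swap] at h
      obtain ⟨x, y, hx, hy, hxy⟩ := hport v u huv.symm h
      exact ⟨y, x, hy, hx, hxy.symm⟩

end Drawing

/-! ### Planar platypuses -/

namespace SimpleGraph

theorem IsPlanar.nonempty_gridMinorModel {V : Type*} [Fintype V] {G : SimpleGraph V}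
    (hG : G.IsPlanar) : Nonempty G.GridMinorModel := by
  obtain ⟨pos, arc, hinj, harc, hvert, hmeet⟩ := hG
  -- Passing to the product gives the sup metric, whose balls are boxes.
  let φ : EuclideanSpace ℝ (Fin 2) → ℝ × ℝ := fun p => (p 0, p 1)
  have hφ : Continuous φ := by fun_prop
  have hφinj : Function.Injective φ := by
    intro p q h
    have h' := Prod.ext_iff.mp h
    ext i
    fin_cases i
    exacts [h'.1, h'.2]
  have harc' : ∀ e ∈ G.edgeSet, IsCompact (arc e) ∧ IsPreconnected (arc e) ∧
      ∀ v ∈ e, pos v ∈ arc e := by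
    intro e he
    induction e with | h u v =>
    obtain ⟨γ, -, hγ⟩ := harc u v he
    rw [← hγ]
    refine ⟨isCompact_range γ.continuous, isPreconnected_range γ.continuous, fun w hw => ?_⟩
    rcases Sym2.mem_iff.mp hw with rfl | rfl
    · exact ⟨0, γ.source⟩
    · exact ⟨1, γ.target⟩
  refine nonempty_gridMinorModel_of_drawing (fun v => φ (pos v)) (fun e => φ '' arc e)
    (hφinj.comp hinj) (fun e he => (harc' e he).1.image hφ)
    (fun e he => (harc' e he).2.1.image φ hφ.continuousOn)
    (fun e he v hv => ⟨_, (harc' e he).2.2 v hv, rfl⟩) (fun e he v hv => ?_)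
    fun e he f hf hef => ?_
  · exact hvert e he v ((hφinj.mem_set_image).mp hv)
  · rw [← Set.image_inter hφinj]
    rintro _ ⟨p, hp, rfl⟩
    obtain ⟨v, -, rfl⟩ := hmeet e he f hf hef hp
    exact ⟨v, rfl⟩

end SimpleGraph

theorem mainTheorem6 {V : Type*} [Fintype V] [DecidableEq V] (G : SimpleGraph V)
    (hG : G.IsPlatypus) (hplanar : G.IsPlanar) :
    G.egirth ≤ 9 := by
  classical
  by_contra! h
  have : Nonempty V := Fintype.card_pos_iff.mp (lt_of_lt_of_le (by norm_num) hG.three_le_card)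
  obtain ⟨M⟩ := hplanar.nonempty_gridMinorModel
  have h10 : 10 ≤ G.egirth := Order.add_one_le_of_lt h
  exact absurd (M.card_edgeFinset_lt h10) (not_lt.mpr hG.five_mul_card_le)
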